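/- **Conventions.** A cone in $\mathbb{R}^N$ is a non-empty closed convex set $K\ne\{0\}$ that is closed under multiplication by nonnegative reals and contains no straight line through $0$. A $K$-parameter convolution semigroup on $\mathbb{R}^d$ is a family $\{\mu_s : s\in K\}$ of probability measures on $\mathbb{R}^d$ with $\mu_{s_1}*\mu_{s_2}=\mu_{s_1+s_2}$ for $s_1,s_2\in K$ and $\mu_{ts}\to\delta_0$ weakly as $t\downarrow 0$ for every $s\in K$. $ID(\mathbb{R}^d)$ is the class of infinitely divisible distributions on $\mathbb{R}^d$, $\widehat\mu$ is the characteristic function of $\mu$, and for $\mu\in ID(\mathbb{R}^d)$ and $t>0$, $\widehat\mu(z)^t=e^{t\psi(z)}$, where $\psi$ is the continuous function with $\psi(0)=0$ and $e^{\psi}=\widehat\mu$. For $b>1$, $L_0(b^{-1},\mathbb{R}^d)$ is the class of distributions $\mu$ on $\mathbb{R}^d$ for which there is $\mu'\in ID(\mathbb{R}^d)$ with $\widehat\mu(z)=\widehat\mu(b^{-1}z)\,\widehat{\mu'}(z)$ for all $z\in\mathbb{R}^d$ (then $\mu'$ is unique); for integers $m\ge 1$, $L_m(b^{-1},\mathbb{R}^d)=\{\mu\in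 L_0(b^{-1},\mathbb{R}^d):\mu'\in L_{m-1}(b^{-1},\mathbb{R}^d)\}$; and $L_\infty(b^{-1},\mathbb{R}^d)=\bigcap_{m=0}^{\infty}L_m(b^{-1},\mathbb{R}^d)$. For $0<\alpha\le 2$ and $b>1$, a distribution $\mu$ on $\mathbb{R}^d$ is strictly $\alpha$-semistable with a span $b$ if $\mu\in ID(\mathbb{R}^d)$ and $\widehat\mu(z)^{b^\alpha}=\widehat\mu(bz)$ for all $z\in\mathbb{R}^d$. **Theorem.** Let $K_1$ and $K_2$ be cones in $\mathbb{R}^{N_1}$ and $\mathbb{R}^{N_2}$, respectively. Let $\{\mu_u : u\in K_2\}$ be a $K_2$-parameter convolution semigroup on $\mathbb{R}^d$, let $\{\rho_s : s\in K_1\}$ be a $K_1$-parameter convolution semigroup on $\mathbb{R}^{N_2}$ with $\mathrm{Supp}(\rho_s)\subseteq K_2$ for every $s\in K_1$, and let $\{\sigma_s : s\in K_1\}$ be the subordinated semigroup on $\mathbb{R}^d$, given by $\sigma_s(B)=\int_{K_2}\mu_u(B)\,\rho_s(du)$ for Borel sets $B\subseteq\mathbb{R}^d$. Suppose that there are $0<\alpha\le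 2$ and $b>1$ such that, for every $u\in K_2$, $\mu_u$ is strictly $\alpha$-semistable with a span $b^{1/\alpha}$. Fix $s\in K_1$. (i) Let $m\in\{0,1,\dots,\infty\}$. If $\rho_s\in L_m(b^{-1},\mathbb{R}^{N_2})$, then $\sigma_s\in L_m(b^{-1/\alpha},\mathbb{R}^d)$. (ii) Let $0<\alpha'\le 1$. If $\rho_s$ is strictly $\alpha'$-semistable with a span $b$, then $\sigma_s$ is strictly $\alpha\alpha'$-semistable with a span $b^{1/\alpha}$. -/

import Mathlib

open MeasureTheory Filter Topology

noncomputable section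

namespace ConeSubordination

/-- `ℝ^n` with its Euclidean norm and inner product. -/
abbrev E (n : ℕ) : Type := EuclideanSpace ℝ (Fin n)

/-- A cone in `ℝ^N`: a non-empty closed convex set, different from `{0}`, that is closed under
multiplication by nonnegative reals and contains no straight line through `0`. -/
structure IsCone {N : ℕ} (K : Set (E N)) : Prop where
  nonempty : K.Nonempty
  isClosed : IsClosed K
  convex : Convex ℝ K
  smul_mem : ∀ t : ℝ, 0 ≤ t → ∀ x ∈ K, t • x ∈ K
  no_line : ∀ x : E N, x ≠ 0 → ¬ ∀ t : ℝ, t • x ∈ K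
  ne_zero : K ≠ {0}

/-- `{μ_s : s ∈ K}` is a `K`-parameter convolution semigroup on `ℝ^d`. The family is written as a
function on all of `ℝ^N`; its values outside `K` play no role. -/
structure IsConvSemigroup {N d : ℕ} (K : Set (E N)) (μ : E N → ProbabilityMeasure (E d)) :
    Prop where
  conv_eq : ∀ s₁ ∈ K, ∀ s₂ ∈ K,
    Measure.conv (μ s₁ : Measure (E d)) (μ s₂ : Measure (E d)) = (μ (s₁ + s₂) : Measure (E d))
  tendsto_zero : ∀ s ∈ K,
    Tendsto (fun t : ℝ => μ (t • s)) (𝓝[>] 0) (𝓝 (diracProba (0 : E d)))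

/-- The mixture `B ↦ ∫_K μ_u(B) ρ(du)` of the family `{μ_u : u ∈ K}` with respect to `ρ`. -/
def mixture {N d : ℕ} (K : Set (E N)) (μ : E N → ProbabilityMeasure (E d))
    (ρ : Measure (E N)) : Measure (E d) :=
  (ρ.restrict K).bind fun u => (μ u : Measure (E d))

/-- The subordinated family `σ_s(B) = ∫_K μ_u(B) ρ_s(du)`. -/
def subordinated {N₁ N₂ d : ℕ} (K : Set (E N₂)) (μ : E N₂ → ProbabilityMeasure (E d))
    (ρ : E N₁ → ProbabilityMeasure (E N₂)) (s : E N₁) : Measure (E d) :=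
  mixture K μ (ρ s : Measure (E N₂))

theorem mixture_apply {N d : ℕ} (K : Set (E N)) (μ : E N → ProbabilityMeasure (E d))
    (ρ : Measure (E N)) (hμ : AEMeasurable (fun u => (μ u : Measure (E d))) (ρ.restrict K))
    (B : Set (E d)) (hB : MeasurableSet B) :
    mixture K μ ρ B = ∫⁻ u in K, (μ u : Measure (E d)) B ∂ρ :=
  Measure.bind_apply hB hμ

/-- The `n`-fold convolution of `ν` with itself. -/
def convPow {d : ℕ} (ν : Measure (E d)) : ℕ → Measure (E d)
  | 0 => Measure.dirac 0
  | n + 1 => Measure.conv (convPow ν n) ν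

/-- `μ ∈ ID(ℝ^d)`: `μ` is an infinitely divisible probability measure. -/
def IsInfDiv {d : ℕ} (μ : Measure (E d)) : Prop :=
  IsProbabilityMeasure μ ∧
    ∀ n : ℕ, 0 < n → ∃ ν : Measure (E d), IsProbabilityMeasure ν ∧ convPow ν n = μ

/-- `μ'` is an infinitely divisible distribution with `μ̂(z) = μ̂(cz) μ̂'(z)`. -/
def IsCofactor {d : ℕ} (c : ℝ) (μ μ' : Measure (E d)) : Prop :=
  IsInfDiv μ' ∧ ∀ z : E d, charFun μ z = charFun μ (c • z) * charFun μ' z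

/-- The class `L_m(c, ℝ^d)` for finite `m`, where `c = b⁻¹` and `b > 1` is the span. The cofactor
is unique when it exists, as the characteristic function of `μ` then has no zeros. -/
def classLNat {d : ℕ} (c : ℝ) : ℕ → Set (Measure (E d))
  | 0 => {μ | IsProbabilityMeasure μ ∧ 0 < c ∧ c < 1 ∧ ∃ μ', IsCofactor c μ μ'}
  | m + 1 => {μ | μ ∈ classLNat c 0 ∧ ∃ μ', IsCofactor c μ μ' ∧ μ' ∈ classLNat c m}

/-- The class `L_m(c, ℝ^d)` for `m ∈ {0, 1, …, ∞}`; `L_∞` is the intersection of all `L_m`. -/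
def classL {d : ℕ} (m : ℕ∞) (c : ℝ) : Set (Measure (E d)) :=
  match m with
  | ⊤ => ⋂ k : ℕ, classLNat c k
  | (k : ℕ) => classLNat c k

/-- `ψ` is the distinguished logarithm of the characteristic function of `μ`: the continuous
function with `ψ(0) = 0` and `exp ψ = μ̂`. It is unique, and real powers of `μ̂` are defined by
`μ̂(z)^t = exp(t ψ(z))`. -/
def IsDistinguishedLog {d : ℕ} (μ : Measure (E d)) (ψ : E d → ℂ) : Prop :=
  Continuous ψ ∧ ψ 0 = 0 ∧ ∀ z : E d, Complex.exp (ψ z) = charFun μ z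

/-- `μ` is strictly `α`-semistable with a span `b`: it is infinitely divisible, `b > 1` and
`μ̂(z)^(b^α) = μ̂(bz)` for all `z`. Meant for `0 < α ≤ 2`. -/
def IsStrictlySemistable {d : ℕ} (α b : ℝ) (μ : Measure (E d)) : Prop :=
  IsInfDiv μ ∧ 1 < b ∧ ∃ ψ : E d → ℂ, IsDistinguishedLog μ ψ ∧
    ∀ z : E d, Complex.exp (((b ^ α : ℝ) : ℂ) * ψ z) = charFun μ (b • z)

end ConeSubordination

end

/-!
The characteristic function of a mixture is `∫ μ̂_u(z) ρ(du)`, so everything reduces to how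
`μ̂_u(z)` depends on `u` in the cone.

Along each ray, `t ↦ μ_{tu}` is a one-parameter convolution semigroup, hence
`μ̂_{tu}(z) = exp(t ψ_u(z))` with `ψ_u` the distinguished logarithm of `μ̂_u`
(`exists_distinguishedLog`). Uniqueness of distinguished logarithms makes `u ↦ ψ_u(z)` additive and
positively homogeneous on the cone, so it is the restriction of a linear functional
(`IsConvSemigroup.exists_linear_log`). In particular `u ↦ μ̂_u(z)` is continuous on the cone, which
makes `u ↦ μ_u` weakly continuous and the mixture meaningful, and mixing turns convolutions into
convolutions (`IsConvSemigroup.mixture_conv`).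

Strict semistability with span `b^{1/α}` says `μ̂_{bu}(z) = μ̂_u(b^{1/α} z)`: dilating the mixing
measure by `b` dilates the mixture by `b^{1/α}`. For the classes `L_m`, mixing is applied to the
factorization of `ρ_s`. This needs the cofactor `ρ'` of `ρ_s`, and the convolution roots of `ρ'`,
to be carried by the cone as well. For roots it holds because `n x` lies in the support of the
`n`-th convolution power when `x` lies in that of the root. For the cofactor, if `x` is in its
support then `y ↦ c y + x`, with `c = b⁻¹`, maps the support of `ρ_s` to itself, so its attracting
fixed point `(1 - c)⁻¹ x` belongs to that support, hence to the cone (`IsCofactor.ae_mem`).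

For the semistable claim, `σ_{ts}` is again a one-parameter convolution semigroup, whence
`σ̂_s(z)^t = σ̂_{ts}(z)`. For `t = b^{α'}` the measure `ρ_{ts}` is the dilation of `ρ_s` by `b`, so
`σ_{ts}` is the dilation of `σ_s` by `b^{1/α}`.
-/

open MeasureTheory Filter Topology

noncomputable section

namespace ConeSubordination

/-! ### Multiplicative functions on the half-line -/

theorem eq_of_exp_mul_eq {w w' : ℂ}
    (h : ∀ t : ℝ, 0 ≤ t → Complex.exp (t * w) = Complex.exp (t * w')) : w = w' := by
  have key : ∀ v : ℂ, HasDerivWithinAt (fun t : ℝ => Complex.exp (t * v)) v (Set.Ici 0) 0 := by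
    intro v
    have h1 : HasDerivAt (fun t : ℝ => (t : ℂ) * v) (1 * v) 0 :=
      (Complex.ofRealCLM.hasDerivAt (x := (0 : ℝ))).mul_const v
    simpa using h1.cexp.hasDerivWithinAt
  have h1 := (key w').congr (fun t ht => h t ht) (h 0 le_rfl)
  exact (uniqueDiffOn_Ici (0 : ℝ) 0 Set.self_mem_Ici).eq_deriv _ (key w) h1

section Scalar

variable {φ : ℝ → ℂ}

theorem multiplicative_zero
    (hmul : ∀ s t : ℝ, 0 ≤ s → 0 ≤ t → φ (s + t) = φ s * φ t)
    (h0 : Tendsto φ (𝓝[>] 0) (𝓝 1)) : φ 0 = 1 := by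
  have h1 : Tendsto (fun t => φ t * φ 0) (𝓝[>] 0) (𝓝 (1 * φ 0)) := h0.mul_const _
  have h2 : (fun t => φ t * φ 0) =ᶠ[𝓝[>] 0] φ := by
    filter_upwards [self_mem_nhdsWithin] with t ht
    have := hmul t 0 (le_of_lt ht) le_rfl
    rw [← this, add_zero]
  have h3 := tendsto_nhds_unique (h1.congr' h2) h0
  simpa using h3

/-- Right continuity at `0` spreads to the whole half-line through
`‖φ t - φ s‖ ≤ ‖φ |t - s| - 1‖`. Composing with `max · 0` gives a continuous function on all of
`ℝ`, to which interval integrals and their derivatives apply. -/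
theorem continuous_multiplicative (hle : ∀ t : ℝ, 0 ≤ t → ‖φ t‖ ≤ 1)
    (hmul : ∀ s t : ℝ, 0 ≤ s → 0 ≤ t → φ (s + t) = φ s * φ t)
    (h0 : Tendsto φ (𝓝[>] 0) (𝓝 1)) : Continuous fun t => φ (max t 0) := by
  have hφ0 := multiplicative_zero hmul h0
  have hw : ContinuousWithinAt φ (Set.Ici 0) 0 := by
    rw [← Set.Ioi_insert, continuousWithinAt_insert_self, ContinuousWithinAt, hφ0]
    exact h0
  have hdist : ∀ s t : ℝ, 0 ≤ s → s ≤ t → ‖φ t - φ s‖ ≤ ‖φ |t - s| - 1‖ := by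
    intro s t hs hst
    have h1 := hmul s (t - s) hs (sub_nonneg.2 hst)
    rw [add_sub_cancel] at h1
    rw [abs_of_nonneg (sub_nonneg.2 hst), h1, ← mul_sub_one, norm_mul]
    exact mul_le_of_le_one_left (norm_nonneg _) (hle s hs)
  have hdist' : ∀ s t : ℝ, 0 ≤ s → 0 ≤ t → ‖φ t - φ s‖ ≤ ‖φ |t - s| - 1‖ := by
    intro s t hs ht
    rcases le_total s t with h | h
    · exact hdist s t hs h
    · rw [norm_sub_rev, abs_sub_comm]; exact hdist t s ht h
  rw [continuous_iff_continuousAt]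
  intro s
  rw [ContinuousAt, tendsto_iff_norm_sub_tendsto_zero]
  refine squeeze_zero (fun _ => norm_nonneg _)
    (fun t => hdist' _ _ (le_max_right s 0) (le_max_right t 0)) ?_
  have h1 : Tendsto (fun t : ℝ => |max t 0 - max s 0|) (𝓝 s) (𝓝[≥] 0) := by
    refine tendsto_nhdsWithin_iff.2 ⟨?_, Eventually.of_forall fun t =>
      Set.mem_Ici.2 (abs_nonneg _)⟩
    have : Continuous fun t : ℝ => |max t 0 - max s 0| := by fun_prop
    simpa using this.tendsto s
  have h2 : Tendsto φ (𝓝[≥] 0) (𝓝 1) := by simpa [ContinuousWithinAt, hφ0] using hw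
  simpa using ((h2.comp h1).sub_const 1).norm

theorem exists_integral_multiplicative_ne_zero (hle : ∀ t : ℝ, 0 ≤ t → ‖φ t‖ ≤ 1)
    (hmul : ∀ s t : ℝ, 0 ≤ s → 0 ≤ t → φ (s + t) = φ s * φ t)
    (h0 : Tendsto φ (𝓝[>] 0) (𝓝 1)) :
    ∃ δ : ℝ, 0 < δ ∧ ∫ t in (0 : ℝ)..δ, φ (max t 0) ≠ 0 := by
  have hc := continuous_multiplicative hle hmul h0
  have hd : HasDerivAt (fun u => ∫ t in (0 : ℝ)..u, φ (max t 0)) (φ (max 0 0)) 0 :=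
    (hc.integral_hasStrictDerivAt 0 0).hasDerivAt
  rw [max_self, multiplicative_zero hmul h0] at hd
  have he : ∀ᶠ u in 𝓝[>] (0 : ℝ), ∫ t in (0 : ℝ)..u, φ (max t 0) ≠ 0 :=
    (hd.eventually_ne one_ne_zero).filter_mono
      (nhdsWithin_mono _ fun x hx => ne_of_gt hx)
  obtain ⟨δ, h1, h2⟩ := (he.and self_mem_nhdsWithin).exists
  exact ⟨δ, h2, h1⟩

/-- The exponent is given by a formula in `φ δ` and `∫₀^δ φ` with one fixed `δ`. When `φ` depends on
a parameter this makes the exponent continuous in the parameter, without any uniformity in the limit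
`φ t → 1`. It comes from `φ u * ∫₀^δ φ = ∫_u^{u+δ} φ`, whose right side is differentiable in `u`. -/
theorem multiplicative_eq_exp (hle : ∀ t : ℝ, 0 ≤ t → ‖φ t‖ ≤ 1)
    (hmul : ∀ s t : ℝ, 0 ≤ s → 0 ≤ t → φ (s + t) = φ s * φ t)
    (h0 : Tendsto φ (𝓝[>] 0) (𝓝 1)) {δ : ℝ} (hδ : 0 < δ)
    (hA : ∫ t in (0 : ℝ)..δ, φ (max t 0) ≠ 0) {t : ℝ} (ht : 0 ≤ t) :
    φ t = Complex.exp (t * ((φ δ - 1) / ∫ r in (0 : ℝ)..δ, φ (max r 0))) := by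
  have hc := continuous_multiplicative hle hmul h0
  set A := ∫ t in (0 : ℝ)..δ, φ (max t 0) with hAdef
  set w := (φ δ - 1) / A with hw
  let F : ℝ → ℂ := fun u => ∫ r in (0 : ℝ)..u, φ (max r 0)
  have hF : ∀ u, HasDerivAt F (φ (max u 0)) u := fun u =>
    (hc.integral_hasStrictDerivAt 0 u).hasDerivAt
  have hint : ∀ u v : ℝ, IntervalIntegrable (fun r => φ (max r 0)) volume u v :=
    fun u v => hc.intervalIntegrable u v
  have hφ : ∀ u, 0 ≤ u → φ u = (F (u + δ) - F u) / A := by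
    intro u hu
    rw [eq_div_iff hA, hAdef, ← intervalIntegral.integral_const_mul,
      intervalIntegral.integral_interval_sub_left (hint _ _) (hint _ _)]
    have h1 : ∫ r in u..u + δ, φ (max r 0) = ∫ r in (0 : ℝ)..δ, φ (max (r + u) 0) := by
      rw [intervalIntegral.integral_comp_add_right (fun r => φ (max r 0)), zero_add, add_comm]
    rw [h1]
    refine intervalIntegral.integral_congr fun r hr => ?_
    rw [Set.uIcc_of_le hδ.le] at hr
    rw [max_eq_left hr.1, max_eq_left (add_nonneg hr.1 hu), add_comm r u, hmul u r hu hr.1]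
  have hderiv : ∀ u, 0 ≤ u → HasDerivWithinAt φ (φ u * w) (Set.Ici u) u := by
    intro u hu
    have h1 : HasDerivAt (fun v => (F (v + δ) - F v) / A)
        ((φ (max (u + δ) 0) - φ (max u 0)) / A) u :=
      (((hF (u + δ)).comp_add_const u δ).sub (hF u)).div_const A
    have h2 : (φ (max (u + δ) 0) - φ (max u 0)) / A = φ u * w := by
      rw [max_eq_left hu, max_eq_left (add_nonneg hu hδ.le), hmul u δ hu hδ.le, hw]
      ring
    rw [h2] at h1
    exact h1.hasDerivWithinAt.congr (fun v hv => hφ v (hu.trans hv)) (hφ u hu)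
  have hprod : ∀ u, 0 ≤ u →
      HasDerivWithinAt (fun v : ℝ => φ v * Complex.exp (-(v * w))) 0 (Set.Ici u) u := by
    intro u hu
    have h1 : HasDerivAt (fun v : ℝ => -((v : ℂ) * w)) (-(1 * w)) u :=
      ((Complex.ofRealCLM.hasDerivAt (x := u)).mul_const w).neg
    have h2 := (hderiv u hu).mul h1.cexp.hasDerivWithinAt
    refine h2.congr_deriv ?_
    ring
  have hcon : ContinuousOn (fun v : ℝ => φ v * Complex.exp (-(v * w))) (Set.Icc 0 t) := by
    refine ContinuousOn.mul ?_ (by fun_prop)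
    refine hc.continuousOn.congr fun v hv => ?_
    simp only
    rw [max_eq_left hv.1]
  have h1 := constant_of_has_deriv_right_zero hcon (fun u hu => hprod u hu.1) t ⟨ht, le_rfl⟩
  simp only [Complex.ofReal_zero, zero_mul, neg_zero, Complex.exp_zero, mul_one,
    multiplicative_zero hmul h0, Complex.exp_neg] at h1
  exact (mul_inv_eq_one₀ (Complex.exp_ne_zero _)).1 h1

end Scalar

/-- The length `δ` for which `∫₀^δ f t x dt ≠ 0` depends on `x`, but one that works at `x₀`
works near `x₀`, and the exponent does not depend on the choice. -/
theorem exists_continuous_exponent {X : Type*} [TopologicalSpace X] [FirstCountableTopology X]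
    {f : ℝ → X → ℂ} (hle : ∀ t : ℝ, 0 ≤ t → ∀ x, ‖f t x‖ ≤ 1)
    (hcont : ∀ t : ℝ, 0 ≤ t → Continuous (f t))
    (hmul : ∀ s t : ℝ, 0 ≤ s → 0 ≤ t → ∀ x, f (s + t) x = f s x * f t x)
    (h0 : ∀ x, Tendsto (fun t => f t x) (𝓝[>] 0) (𝓝 1)) :
    ∃ ψ : X → ℂ, Continuous ψ ∧ ∀ t : ℝ, 0 ≤ t → ∀ x, f t x = Complex.exp (t * ψ x) := by
  have hex := fun x => exists_integral_multiplicative_ne_zero (φ := fun t => f t x)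
    (fun t ht => hle t ht x) (fun s t hs ht => hmul s t hs ht x) (h0 x)
  choose δ hδ hA using hex
  have hexp : ∀ (x : X) {d : ℝ}, 0 < d → ∫ t in (0 : ℝ)..d, f (max t 0) x ≠ 0 →
      ∀ t : ℝ, 0 ≤ t →
        f t x = Complex.exp (t * ((f d x - 1) / ∫ r in (0 : ℝ)..d, f (max r 0) x)) :=
    fun x d hd hA t ht => multiplicative_eq_exp (φ := fun t => f t x)
      (fun t ht => hle t ht x) (fun s t hs ht => hmul s t hs ht x) (h0 x) hd hA ht
  refine ⟨fun x => (f (δ x) x - 1) / ∫ r in (0 : ℝ)..δ x, f (max r 0) x, ?_,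
    fun t ht x => hexp x (hδ x) (hA x) t ht⟩
  rw [continuous_iff_continuousAt]
  intro x₀
  have hAc : Continuous fun x => ∫ r in (0 : ℝ)..δ x₀, f (max r 0) x := by
    refine intervalIntegral.continuous_of_dominated_interval (bound := fun _ => 1) (fun x => ?_)
      (fun x => Eventually.of_forall fun t _ => hle _ (le_max_right t 0) x)
      (by simp) (Eventually.of_forall fun t _ => hcont _ (le_max_right t 0))
    exact (continuous_multiplicative (φ := fun t => f t x) (fun t ht => hle t ht x)
      (fun s t hs ht => hmul s t hs ht x) (h0 x)).aestronglyMeasurable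
  have hloc : ContinuousAt
      (fun x => (f (δ x₀) x - 1) / ∫ r in (0 : ℝ)..δ x₀, f (max r 0) x) x₀ :=
    (((hcont _ (hδ x₀).le).sub continuous_const).continuousAt).div hAc.continuousAt (hA x₀)
  refine hloc.congr ?_
  filter_upwards [hAc.continuousAt.eventually_ne (hA x₀)] with x hx
  refine eq_of_exp_mul_eq fun t ht => ?_
  rw [← hexp x (hδ x₀) hx t ht, ← hexp x (hδ x) (hA x) t ht]

/-- The difference of the two logarithms takes values in `2πiℤ`, so the set where it vanishes
is also the set where its norm is less than `1`: it is closed and open. -/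
theorem eq_of_exp_eq {X : Type*} [TopologicalSpace X] [PreconnectedSpace X] {ψ φ : X → ℂ}
    (hψ : Continuous ψ) (hφ : Continuous φ) (h : ∀ x, Complex.exp (ψ x) = Complex.exp (φ x))
    {x₀ : X} (h0 : ψ x₀ = φ x₀) : ψ = φ := by
  have hset : {x | ψ x = φ x} = {x | ‖ψ x - φ x‖ < 1} := by
    ext x
    simp only [Set.mem_ofPred_eq]
    refine ⟨fun hx => by simp [hx], fun hx => ?_⟩
    obtain ⟨n, hn⟩ := Complex.exp_eq_exp_iff_exists_int.1 (h x)
    rw [hn, add_sub_cancel_left] at hx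
    have hn0 : n = 0 := by
      by_contra hne
      have h1 : (1 : ℝ) ≤ |(n : ℝ)| := by exact_mod_cast Int.one_le_abs hne
      have h2 : ‖(n : ℂ) * (2 * Real.pi * Complex.I)‖ = |(n : ℝ)| * (2 * Real.pi) := by
        simp [abs_of_pos Real.pi_pos]
      rw [h2] at hx
      nlinarith [Real.pi_gt_three]
    simp [hn, hn0]
  have hclopen : IsClopen {x | ψ x = φ x} := by
    refine ⟨isClosed_eq hψ hφ, ?_⟩
    rw [hset]
    exact isOpen_lt (by fun_prop) continuous_const
  have huniv := hclopen.eq_univ ⟨x₀, h0⟩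
  funext x
  exact (Set.ext_iff.1 huniv x).2 trivial

/-! ### Linear extension from a cone -/

/-- A function that is additive and positively homogeneous on a convex cone extends to a linear map
on the whole space: it is prescribed on a maximal linearly independent subset of the cone, and
elements of the span are differences of elements of the cone. -/
theorem exists_linearMap_eqOn {V W : Type*} [AddCommGroup V] [Module ℝ V] [AddCommGroup W]
    [Module ℝ W] {K : Set V} (hadd : ∀ x ∈ K, ∀ y ∈ K, x + y ∈ K)
    (hsmul : ∀ t : ℝ, 0 ≤ t → ∀ x ∈ K, t • x ∈ K) {ℓ : V → W}
    (hℓadd : ∀ x ∈ K, ∀ y ∈ K, ℓ (x + y) = ℓ x + ℓ y)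
    (hℓsmul : ∀ t : ℝ, 0 ≤ t → ∀ x ∈ K, ℓ (t • x) = t • ℓ x) :
    ∃ L : V →ₗ[ℝ] W, ∀ x ∈ K, L x = ℓ x := by
  obtain ⟨s, hsK, hspan, hli⟩ := exists_linearIndependent ℝ K
  have hli : LinearIndepOn ℝ id s := hli
  let B := Module.Basis.extend hli
  let L : V →ₗ[ℝ] W := B.constr ℝ fun i => ℓ i
  have hLs : ∀ x ∈ s, L x = ℓ x := by
    intro x hx
    have h1 : B ⟨x, hli.subset_extend (Set.subset_univ s) hx⟩ = x :=
      Module.Basis.extend_apply_self _ _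
    conv_lhs => rw [← h1]
    exact B.constr_basis ℝ _ _
  have key : ∀ x ∈ Submodule.span ℝ s, x = 0 ∨
      ∃ p ∈ K, ∃ q ∈ K, x = p - q ∧ L x = ℓ p - ℓ q := by
    intro x hx
    induction hx using Submodule.span_induction with
    | mem x hx =>
      -- `x = 2x - x` avoids asking whether `0` belongs to `K`.
      refine Or.inr ⟨(2 : ℝ) • x, hsmul _ zero_le_two _ (hsK hx), x, hsK hx, ?_, ?_⟩
      · rw [two_smul, add_sub_cancel_right]
      · rw [hℓsmul _ zero_le_two _ (hsK hx), hLs x hx, two_smul, add_sub_cancel_right]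
    | zero => exact Or.inl rfl
    | add x y _ _ hx hy =>
      rcases hx with rfl | ⟨p, hp, q, hq, hx, hLx⟩
      · rwa [zero_add]
      rcases hy with rfl | ⟨p', hp', q', hq', hy, hLy⟩
      · rw [add_zero]; exact Or.inr ⟨p, hp, q, hq, hx, hLx⟩
      refine Or.inr ⟨p + p', hadd _ hp _ hp', q + q', hadd _ hq _ hq', ?_, ?_⟩
      · rw [hx, hy]; abel
      · rw [map_add, hLx, hLy, hℓadd _ hp _ hp', hℓadd _ hq _ hq']; abel
    | smul a x _ hx =>
      rcases hx with rfl | ⟨p, hp, q, hq, hx, hLx⟩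
      · exact Or.inl (smul_zero a)
      rcases le_total 0 a with ha | ha
      · refine Or.inr ⟨a • p, hsmul _ ha _ hp, a • q, hsmul _ ha _ hq, ?_, ?_⟩
        · rw [hx, smul_sub]
        · rw [map_smul, hLx, hℓsmul _ ha _ hp, hℓsmul _ ha _ hq, smul_sub]
      · have ha' : 0 ≤ -a := neg_nonneg.2 ha
        refine Or.inr ⟨(-a) • q, hsmul _ ha' _ hq, (-a) • p, hsmul _ ha' _ hp, ?_, ?_⟩
        · rw [hx, smul_sub, neg_smul, neg_smul]; abel
        · rw [map_smul, hLx, hℓsmul _ ha' _ hp, hℓsmul _ ha' _ hq, smul_sub, neg_smul, neg_smul]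
          abel
  refine ⟨L, fun x hx => ?_⟩
  rcases key x (hspan ▸ Submodule.subset_span hx) with rfl | ⟨p, hp, q, hq, h1, h2⟩
  · have := hℓsmul 0 le_rfl 0 hx
    rw [zero_smul, zero_smul] at this
    rw [map_zero, this]
  · have h3 : x + q = p := by rw [h1, sub_add_cancel]
    rw [h2, ← h3, hℓadd _ hx _ hq, add_sub_cancel_right]

/-! ### Distinguished logarithms of convolution semigroups -/

theorem isDistinguishedLog_unique {d : ℕ} {μ : Measure (E d)} {ψ φ : E d → ℂ}
    (hψ : IsDistinguishedLog μ ψ) (hφ : IsDistinguishedLog μ φ) : ψ = φ :=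
  eq_of_exp_eq hψ.1 hφ.1 (fun z => (hψ.2.2 z).trans (hφ.2.2 z).symm) (hψ.2.1.trans hφ.2.1.symm)

/-- A one-parameter convolution semigroup `ν_t`, `t ≥ 0`, has characteristic functions
`exp(t ψ(z))`, with `ψ` the distinguished logarithm of `ν_1`. -/
theorem exists_distinguishedLog {d : ℕ} {ν : ℝ → Measure (E d)}
    (hprob : ∀ t : ℝ, 0 ≤ t → IsProbabilityMeasure (ν t))
    (hconv : ∀ s t : ℝ, 0 ≤ s → 0 ≤ t → Measure.conv (ν s) (ν t) = ν (s + t))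
    (hlim : ∀ z : E d, Tendsto (fun t => charFun (ν t) z) (𝓝[>] 0) (𝓝 1)) :
    ∃ ψ : E d → ℂ, IsDistinguishedLog (ν 1) ψ ∧
      ∀ t : ℝ, 0 ≤ t → ∀ z, charFun (ν t) z = Complex.exp (t * ψ z) := by
  obtain ⟨ψ, hψ, h⟩ := exists_continuous_exponent (f := fun t z => charFun (ν t) z)
    (fun t ht z => by have := hprob t ht; exact norm_charFun_le_one z)
    (fun t ht => by have := hprob t ht; fun_prop)
    (fun s t hs ht z => by
      have := hprob s hs
      have := hprob t ht
      rw [← hconv s t hs ht, charFun_conv])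
    hlim
  refine ⟨ψ, ⟨hψ, eq_of_exp_mul_eq fun t ht => ?_, fun z => ?_⟩, h⟩
  · have := hprob t ht
    rw [← h t ht 0, charFun_zero]
    simp
  · simp [h 1 zero_le_one z]

theorem IsCone.add_mem {N : ℕ} {K : Set (E N)} (hK : IsCone K) {x y : E N} (hx : x ∈ K)
    (hy : y ∈ K) : x + y ∈ K := by
  have h := hK.smul_mem 2 zero_le_two _
    (hK.convex hx hy (a := 1 / 2) (b := 1 / 2) (by norm_num) (by norm_num) (by norm_num))
  rwa [smul_add, smul_smul, smul_smul, show (2 : ℝ) * (1 / 2) = 1 by norm_num, one_smul,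
    one_smul] at h

theorem IsCone.zero_mem {N : ℕ} {K : Set (E N)} (hK : IsCone K) : (0 : E N) ∈ K := by
  obtain ⟨x, hx⟩ := hK.nonempty
  simpa using hK.smul_mem 0 le_rfl x hx

theorem tendsto_integral_of_tendsto {N : ℕ} {ι : Type*} {l : Filter ι}
    {ν : ι → ProbabilityMeasure (E N)} (h : Tendsto ν l (𝓝 (diracProba 0)))
    (g : BoundedContinuousFunction (E N) ℂ) :
    Tendsto (fun i => ∫ x, g x ∂(ν i : Measure (E N))) l (𝓝 (g 0)) := by
  have := (ProbabilityMeasure.tendsto_iff_forall_integral_rclike_tendsto ℂ).1 h g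
  simpa [diracProba] using this

theorem tendsto_charFun_of_tendsto {N : ℕ} {ι : Type*} {l : Filter ι}
    {ν : ι → ProbabilityMeasure (E N)} (h : Tendsto ν l (𝓝 (diracProba 0))) (z : E N) :
    Tendsto (fun i => charFun (ν i : Measure (E N)) z) l (𝓝 1) := by
  have h1 := tendsto_integral_of_tendsto h (BoundedContinuousFunction.innerProbChar z)
  simp_rw [charFun_eq_integral_innerProbChar]
  simpa [BoundedContinuousFunction.innerProbChar_apply] using h1

section Semigroup

variable {N d : ℕ} {K : Set (E N)} {μ : E N → ProbabilityMeasure (E d)}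

theorem IsConvSemigroup.exists_distinguishedLog (hK : IsCone K) (hμ : IsConvSemigroup K μ)
    {u : E N} (hu : u ∈ K) :
    ∃ ψ : E d → ℂ, IsDistinguishedLog (μ u : Measure (E d)) ψ ∧
      ∀ t : ℝ, 0 ≤ t → ∀ z,
        charFun (μ (t • u) : Measure (E d)) z = Complex.exp (t * ψ z) := by
  have h := ConeSubordination.exists_distinguishedLog
    (ν := fun t : ℝ => (μ (t • u) : Measure (E d))) (fun t _ => inferInstance)
    (fun s t hs ht => by
      rw [hμ.conv_eq _ (hK.smul_mem s hs u hu) _ (hK.smul_mem t ht u hu), ← add_smul])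
    (tendsto_charFun_of_tendsto (hμ.tendsto_zero u hu))
  simpa only [one_smul] using h

/-- The distinguished logarithm of `μ̂_u(z)` is linear in `u`; no regularity of `u ↦ μ_u` beyond
that along rays enters. -/
theorem IsConvSemigroup.exists_linear_log (hK : IsCone K) (hμ : IsConvSemigroup K μ) :
    ∃ L : E d → E N →ₗ[ℝ] ℂ, ∀ u ∈ K,
      IsDistinguishedLog (μ u : Measure (E d)) fun z => L z u := by
  choose! Ψ hΨ hΨexp using fun u (hu : u ∈ K) => hμ.exists_distinguishedLog hK hu
  have hadd : ∀ u ∈ K, ∀ v ∈ K, Ψ (u + v) = Ψ u + Ψ v := by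
    intro u hu v hv
    refine isDistinguishedLog_unique (hΨ _ (hK.add_mem hu hv))
      ⟨(hΨ u hu).1.add (hΨ v hv).1, ?_, fun z => ?_⟩
    · rw [Pi.add_apply, (hΨ u hu).2.1, (hΨ v hv).2.1, add_zero]
    · rw [Pi.add_apply, Complex.exp_add, (hΨ u hu).2.2, (hΨ v hv).2.2,
        ← hμ.conv_eq u hu v hv, charFun_conv]
  have hsmul : ∀ t : ℝ, 0 ≤ t → ∀ u ∈ K, Ψ (t • u) = t • Ψ u := by
    intro t ht u hu
    refine isDistinguishedLog_unique (hΨ _ (hK.smul_mem t ht u hu))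
      ⟨(hΨ u hu).1.const_smul t, ?_, fun z => ?_⟩
    · rw [Pi.smul_apply, (hΨ u hu).2.1, smul_zero]
    · rw [Pi.smul_apply, Complex.real_smul, hΨexp u hu t ht]
  choose L hL using fun z : E d => exists_linearMap_eqOn (K := K) (ℓ := fun u => Ψ u z)
    (fun x hx y hy => hK.add_mem hx hy) hK.smul_mem
    (fun x hx y hy => by rw [hadd x hx y hy, Pi.add_apply])
    (fun t ht x hx => by rw [hsmul t ht x hx, Pi.smul_apply])
  refine ⟨L, fun u hu => ?_⟩
  simpa only [hL _ u hu] using hΨ u hu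

/-- The linear extension of the logarithm has nonpositive real part on the cone only, so
`exp ∘ L` may be unbounded elsewhere. Replacing `Re` by `-|Re|` changes nothing on the cone. -/
theorem IsConvSemigroup.exists_bounded_extension (hK : IsCone K) (hμ : IsConvSemigroup K μ)
    (z : E d) : ∃ g : BoundedContinuousFunction (E N) ℂ, g 0 = 1 ∧
      ∀ u ∈ K, charFun (μ u : Measure (E d)) z = g u := by
  obtain ⟨L, hL⟩ := hμ.exists_linear_log hK
  have hLc : Continuous (L z) := (L z).continuous_of_finiteDimensional
  let h : E N → ℂ := fun u => Complex.exp (⟨-|(L z u).re|, (L z u).im⟩ : ℂ)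
  have hh : h = fun u =>
      Complex.exp (((-|(L z u).re| : ℝ) : ℂ) + ((L z u).im : ℂ) * Complex.I) := by
    funext u
    simp only [h]
    congr 1
    exact Complex.mk_eq_add_mul_I _ _
  have hc : Continuous h := by
    rw [hh]
    have h1 := Complex.continuous_re.comp hLc
    have h2 := Complex.continuous_im.comp hLc
    simp only [Function.comp_def] at h1 h2
    fun_prop
  refine ⟨BoundedContinuousFunction.ofNormedAddCommGroup h hc 1 fun u => ?_, ?_, fun u hu => ?_⟩
  · simp only [h, Complex.norm_exp]
    exact Real.exp_le_one_iff.2 (neg_nonpos.2 (abs_nonneg _))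
  · rw [BoundedContinuousFunction.coe_ofNormedAddCommGroup, hh]
    simp
  · have hexp := (hL u hu).2.2 z
    have hre : (L z u).re ≤ 0 := by
      have h1 : ‖charFun (μ u : Measure (E d)) z‖ ≤ 1 := norm_charFun_le_one z
      rw [← hexp, Complex.norm_exp] at h1
      exact Real.exp_le_one_iff.1 h1
    rw [BoundedContinuousFunction.coe_ofNormedAddCommGroup, ← hexp]
    simp only [h, abs_of_nonpos hre, neg_neg]

/-! ### Continuity in the parameter and mixtures -/

theorem measurable_of_continuous_probabilityMeasure {X : Type*} [TopologicalSpace X]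
    [MeasurableSpace X] [OpensMeasurableSpace X] {κ : X → ProbabilityMeasure (E d)}
    (hκ : Continuous κ) : Measurable fun x => (κ x : Measure (E d)) := by
  refine Measurable.measure_of_isPiSystem_of_isProbabilityMeasure
    ((BorelSpace.measurable_eq (α := E d)).trans borel_eq_generateFrom_isClosed)
    isPiSystem_isClosed fun F hF => ?_
  obtain ⟨δ, -, hδ, hlim⟩ := exists_seq_strictAnti_tendsto (0 : ℝ)
  refine measurable_of_tendsto_metrizable (fun n => ?_)
    (tendsto_pi_nhds.2 fun x => tendsto_lintegral_thickenedIndicator_of_isClosed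
      (κ x : Measure (E d)) hF hδ hlim)
  exact ((ProbabilityMeasure.continuous_iff_forall_continuous_lintegral.1 hκ) _).measurable

theorem IsConvSemigroup.continuousOn (hK : IsCone K) (hμ : IsConvSemigroup K μ) :
    ContinuousOn μ K := by
  rw [continuousOn_iff_continuous_domRestrict, continuous_iff_seqContinuous]
  intro x u hx
  refine ProbabilityMeasure.tendsto_of_tendsto_charFun fun z => ?_
  obtain ⟨g, -, hg⟩ := hμ.exists_bounded_extension hK z
  have h1 := (g.continuous.comp continuous_subtype_val).continuousAt.tendsto.comp hx
  simpa [Function.comp_def, hg _ (Subtype.coe_prop _)] using h1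

/-- The family may fail to be measurable off the cone, where it is replaced by `δ_0`. -/
theorem IsConvSemigroup.exists_kernel (hK : IsCone K) (hμ : IsConvSemigroup K μ) :
    ∃ κ : ProbabilityTheory.Kernel (E N) (E d), ProbabilityTheory.IsMarkovKernel κ ∧
      ∀ u ∈ K, κ u = (μ u : Measure (E d)) := by
  classical
  have hm : Measurable fun u => if u ∈ K then (μ u : Measure (E d)) else Measure.dirac 0 := by
    refine measurable_of_restrict_of_restrict_compl hK.isClosed.measurableSet ?_ ?_
    · convert! measurable_of_continuous_probabilityMeasure
        (continuousOn_iff_continuous_domRestrict.1 (hμ.continuousOn hK)) using 1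
      funext u
      exact if_pos u.2
    · convert! measurable_const (a := Measure.dirac (0 : E d)) using 1
      funext u
      exact if_neg u.2
  refine ⟨⟨_, hm⟩, ⟨fun u => ?_⟩, fun u hu => ?_⟩
  · change IsProbabilityMeasure (if u ∈ K then (μ u : Measure (E d)) else Measure.dirac 0)
    split_ifs <;> infer_instance
  · exact if_pos hu

theorem IsConvSemigroup.exists_mixture_eq_comp (hK : IsCone K) (hμ : IsConvSemigroup K μ) :
    ∃ κ : ProbabilityTheory.Kernel (E N) (E d), ProbabilityTheory.IsMarkovKernel κ ∧
      (∀ u ∈ K, κ u = (μ u : Measure (E d))) ∧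
      ∀ ν : Measure (E N), (∀ᵐ u ∂ν, u ∈ K) → mixture K μ ν = ν.bind κ := by
  obtain ⟨κ, hκ, hκμ⟩ := hμ.exists_kernel hK
  refine ⟨κ, hκ, hκμ, fun ν hν => ?_⟩
  rw [mixture, Measure.restrict_eq_self_of_ae_mem hν]
  refine Measure.bind_congr_right ?_
  filter_upwards [hν] with u hu using (hκμ u hu).symm

variable {ν : Measure (E N)}

theorem IsConvSemigroup.isProbabilityMeasure_mixture (hK : IsCone K) (hμ : IsConvSemigroup K μ)
    [IsProbabilityMeasure ν] (hν : ∀ᵐ u ∂ν, u ∈ K) : IsProbabilityMeasure (mixture K μ ν) := by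
  obtain ⟨κ, hκ, -, h⟩ := hμ.exists_mixture_eq_comp hK
  rw [h ν hν]
  infer_instance

theorem IsConvSemigroup.charFun_mixture (hK : IsCone K) (hμ : IsConvSemigroup K μ)
    [IsProbabilityMeasure ν] (hν : ∀ᵐ u ∂ν, u ∈ K) (z : E d) :
    charFun (mixture K μ ν) z = ∫ u, charFun (μ u : Measure (E d)) z ∂ν := by
  obtain ⟨κ, hκ, hκμ, h⟩ := hμ.exists_mixture_eq_comp hK
  rw [h ν hν, Measure.comp_eq_comp_const_apply, charFun_apply,
    ProbabilityTheory.Kernel.integral_comp]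
  · rw [ProbabilityTheory.Kernel.const_apply]
    refine integral_congr_ae ?_
    filter_upwards [hν] with u hu
    rw [hκμ u hu, charFun_apply]
  · rw [← Measure.comp_eq_comp_const_apply]
    exact (integrable_const (1 : ℝ)).mono (by fun_prop) (by simp)

theorem IsConvSemigroup.integrable_charFun (hK : IsCone K) (hμ : IsConvSemigroup K μ)
    [IsProbabilityMeasure ν] (hν : ∀ᵐ u ∂ν, u ∈ K) (z : E d) :
    Integrable (fun u => charFun (μ u : Measure (E d)) z) ν := by
  obtain ⟨g, -, hg⟩ := hμ.exists_bounded_extension hK z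
  refine (g.integrable ν).congr ?_
  filter_upwards [hν] with u hu using (hg u hu).symm

theorem IsCone.ae_mem_dirac_zero (hK : IsCone K) : ∀ᵐ u ∂(Measure.dirac (0 : E N)), u ∈ K :=
  (ae_dirac_iff (p := (· ∈ K)) hK.isClosed.measurableSet).2 hK.zero_mem

theorem IsCone.ae_mem_map_smul (hK : IsCone K) (hν : ∀ᵐ u ∂ν, u ∈ K) {r : ℝ} (hr : 0 ≤ r) :
    ∀ᵐ u ∂(ν.map (r • ·)), u ∈ K := by
  rw [ae_map_iff (p := (· ∈ K)) (by fun_prop) hK.isClosed.measurableSet]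
  filter_upwards [hν] with u hu using hK.smul_mem r hr u hu

theorem IsCone.ae_mem_conv (hK : IsCone K) {ν₁ ν₂ : Measure (E N)} [IsProbabilityMeasure ν₁]
    [IsProbabilityMeasure ν₂] (h₁ : ∀ᵐ u ∂ν₁, u ∈ K) (h₂ : ∀ᵐ u ∂ν₂, u ∈ K) :
    ∀ᵐ u ∂(Measure.conv ν₁ ν₂), u ∈ K := by
  rw [Measure.conv, ae_map_iff (p := (· ∈ K)) (by fun_prop) hK.isClosed.measurableSet]
  have h1 := Measure.quasiMeasurePreserving_fst (μ := ν₁) (ν := ν₂) |>.ae h₁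
  have h2 := Measure.quasiMeasurePreserving_snd (μ := ν₁) (ν := ν₂) |>.ae h₂
  filter_upwards [h1, h2] with p hp hq using hK.add_mem hp hq

/-- Subordination is compatible with convolution: `∫ μ̂_u d(ν₁ ∗ ν₂)` is the integral of
`μ̂_{u+v} = μ̂_u μ̂_v` over `ν₁ × ν₂`. -/
theorem IsConvSemigroup.mixture_conv (hK : IsCone K) (hμ : IsConvSemigroup K μ)
    {ν₁ ν₂ : Measure (E N)} [IsProbabilityMeasure ν₁] [IsProbabilityMeasure ν₂]
    (h₁ : ∀ᵐ u ∂ν₁, u ∈ K) (h₂ : ∀ᵐ u ∂ν₂, u ∈ K) :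
    mixture K μ (Measure.conv ν₁ ν₂) = Measure.conv (mixture K μ ν₁) (mixture K μ ν₂) := by
  have h₁₂ := hK.ae_mem_conv h₁ h₂
  have := hμ.isProbabilityMeasure_mixture hK h₁
  have := hμ.isProbabilityMeasure_mixture hK h₂
  have := hμ.isProbabilityMeasure_mixture hK h₁₂
  refine Measure.ext_of_charFun (funext fun z => ?_)
  rw [charFun_conv, hμ.charFun_mixture hK h₁, hμ.charFun_mixture hK h₂, hμ.charFun_mixture hK h₁₂,
    integral_conv (hμ.integrable_charFun hK h₁₂ z), ← integral_mul_const]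
  refine integral_congr_ae ?_
  filter_upwards [h₁] with u hu
  rw [← integral_const_mul]
  refine integral_congr_ae ?_
  filter_upwards [h₂] with v hv
  rw [← hμ.conv_eq u hu v hv, charFun_conv]

theorem IsConvSemigroup.charFun_zero_param (hK : IsCone K) (hμ : IsConvSemigroup K μ) (z : E d) :
    charFun (μ 0 : Measure (E d)) z = 1 := by
  obtain ⟨g, hg0, hg⟩ := hμ.exists_bounded_extension hK z
  rw [hg 0 hK.zero_mem, hg0]

theorem IsConvSemigroup.mixture_dirac_zero (hK : IsCone K) (hμ : IsConvSemigroup K μ) :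
    mixture K μ (Measure.dirac 0) = Measure.dirac 0 := by
  have h := hK.ae_mem_dirac_zero
  have := hμ.isProbabilityMeasure_mixture hK h
  refine Measure.ext_of_charFun (funext fun z => ?_)
  rw [hμ.charFun_mixture hK h, integral_dirac, hμ.charFun_zero_param hK]
  simp

theorem isProbabilityMeasure_convPow {n : ℕ} (ν : Measure (E n)) [IsProbabilityMeasure ν] (k : ℕ) :
    IsProbabilityMeasure (convPow ν k) := by
  induction k with
  | zero => exact Measure.dirac.isProbabilityMeasure
  | succ k ih => rw [convPow]; infer_instance

theorem IsCone.ae_mem_convPow (hK : IsCone K) [IsProbabilityMeasure ν] (hν : ∀ᵐ u ∂ν, u ∈ K)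
    (k : ℕ) : ∀ᵐ u ∂(convPow ν k), u ∈ K := by
  induction k with
  | zero => exact hK.ae_mem_dirac_zero
  | succ k ih =>
    have := isProbabilityMeasure_convPow ν k
    exact hK.ae_mem_conv ih hν

theorem IsConvSemigroup.mixture_convPow (hK : IsCone K) (hμ : IsConvSemigroup K μ)
    [IsProbabilityMeasure ν] (hν : ∀ᵐ u ∂ν, u ∈ K) (k : ℕ) :
    mixture K μ (convPow ν k) = convPow (mixture K μ ν) k := by
  induction k with
  | zero => exact hμ.mixture_dirac_zero hK
  | succ k ih =>
    have := isProbabilityMeasure_convPow ν k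
    rw [convPow, hμ.mixture_conv hK (hK.ae_mem_convPow hν k) hν, ih, convPow]

/-! ### Supports of convolution factors -/

theorem add_mem_support_conv {ν₁ ν₂ : Measure (E N)} [IsProbabilityMeasure ν₁]
    [IsProbabilityMeasure ν₂] {x y : E N} (hx : x ∈ ν₁.support) (hy : y ∈ ν₂.support) :
    x + y ∈ (Measure.conv ν₁ ν₂).support := by
  rw [Measure.mem_support_iff_forall] at hx hy ⊢
  intro U hU
  have h1 : (fun p : E N × E N => p.1 + p.2) ⁻¹' U ∈ 𝓝 (x, y) :=
    (continuous_add.tendsto (x, y)) hU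
  rw [nhds_prod_eq] at h1
  obtain ⟨V, hV, W, hW, hVW⟩ := mem_prod_iff.1 h1
  calc 0 < ν₁ V * ν₂ W := ENNReal.mul_pos (hx V hV).ne' (hy W hW).ne'
    _ = (ν₁.prod ν₂) (V ×ˢ W) := (Measure.prod_prod V W).symm
    _ ≤ (ν₁.prod ν₂) ((fun p : E N × E N => p.1 + p.2) ⁻¹' U) := measure_mono hVW
    _ ≤ Measure.conv ν₁ ν₂ U := Measure.le_map_apply (by fun_prop) U

theorem smul_mem_support_map {x : E N} (hx : x ∈ ν.support) (c : ℝ) :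
    c • x ∈ (ν.map (c • ·)).support := by
  rw [Measure.mem_support_iff_forall] at hx ⊢
  intro U hU
  have hc : Continuous fun y : E N => c • y := continuous_const_smul c
  exact (hx _ (hc.continuousAt hU)).trans_le (Measure.le_map_apply hc.aemeasurable U)

theorem nsmul_mem_support_convPow [IsProbabilityMeasure ν] {x : E N} (hx : x ∈ ν.support)
    (k : ℕ) : k • x ∈ (convPow ν k).support := by
  induction k with
  | zero =>
    rw [zero_smul, Measure.mem_support_iff_forall]
    intro U hU
    rw [convPow, Measure.dirac_apply_of_mem (mem_of_mem_nhds hU)]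
    exact one_pos
  | succ k ih =>
    have := isProbabilityMeasure_convPow ν k
    rw [succ_nsmul]
    exact add_mem_support_conv ih hx

theorem ae_mem_iff_support_subset (hK : IsClosed K) : (∀ᵐ u ∂ν, u ∈ K) ↔ ν.support ⊆ K :=
  ⟨fun h => Measure.support_subset_of_isClosed hK h,
    fun h => mem_of_superset Measure.support_mem_ae h⟩

/-- Convolution roots of a measure carried by a cone are carried by the cone. -/
theorem IsCone.ae_mem_of_convPow (hK : IsCone K) [IsProbabilityMeasure ν] {k : ℕ} (hk : 0 < k)
    (h : ∀ᵐ u ∂(convPow ν k), u ∈ K) : ∀ᵐ u ∂ν, u ∈ K := by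
  rw [ae_mem_iff_support_subset hK.isClosed] at h ⊢
  intro x hx
  have h1 := hK.smul_mem (k : ℝ)⁻¹ (by positivity) _ (h (nsmul_mem_support_convPow hx k))
  rwa [← Nat.cast_smul_eq_nsmul ℝ, smul_smul, inv_mul_cancel₀ (by positivity), one_smul] at h1

/-! ### Infinite divisibility, semistability and the classes `L_m` -/

theorem IsConvSemigroup.isInfDiv_mixture (hK : IsCone K) (hμ : IsConvSemigroup K μ)
    (hν : ∀ᵐ u ∂ν, u ∈ K) (hid : IsInfDiv ν) : IsInfDiv (mixture K μ ν) := by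
  have := hid.1
  refine ⟨hμ.isProbabilityMeasure_mixture hK hν, fun n hn => ?_⟩
  obtain ⟨η, hη, hηn⟩ := hid.2 n hn
  have hηK : ∀ᵐ u ∂η, u ∈ K := hK.ae_mem_of_convPow hn (hηn ▸ hν)
  exact ⟨mixture K μ η, hμ.isProbabilityMeasure_mixture hK hηK, by
    rw [← hμ.mixture_convPow hK hηK, hηn]⟩

theorem IsCofactor.eq_conv {c : ℝ} {ν' : Measure (E N)} [IsProbabilityMeasure ν]
    (h : IsCofactor c ν ν') : ν = Measure.conv (ν.map (c • ·)) ν' := by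
  have := h.1.1
  have : IsProbabilityMeasure (ν.map (c • ·)) := Measure.isProbabilityMeasure_map (by fun_prop)
  refine Measure.ext_of_charFun (funext fun z => ?_)
  rw [charFun_conv, charFun_map_smul, h.2 z]

/-- The cofactor of a measure carried by a cone is carried by the cone. -/
theorem IsCofactor.ae_mem (hK : IsCone K) {c : ℝ} (hc0 : 0 < c) (hc1 : c < 1)
    {ν' : Measure (E N)} [IsProbabilityMeasure ν] (hν : ∀ᵐ u ∂ν, u ∈ K)
    (h : IsCofactor c ν ν') : ∀ᵐ u ∂ν', u ∈ K := by
  have := h.1.1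
  have : IsProbabilityMeasure (ν.map (c • ·)) := Measure.isProbabilityMeasure_map (by fun_prop)
  rw [ae_mem_iff_support_subset hK.isClosed] at hν ⊢
  intro x hx
  have hmaps : ∀ y ∈ ν.support, c • y + x ∈ ν.support := by
    intro y hy
    have := add_mem_support_conv (smul_mem_support_map hy c) hx
    rwa [← h.eq_conv] at this
  obtain ⟨y, hy⟩ := Measure.nonempty_support (μ := ν) (IsProbabilityMeasure.ne_zero ν)
  have hpt : (1 - c)⁻¹ • x ∈ ν.support := by
    -- The orbit of `y` under `y ↦ c y + x`, written around the fixed point `(1 - c)⁻¹ x`.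
    have hiter : ∀ n : ℕ, (1 - c)⁻¹ • x + c ^ n • (y - (1 - c)⁻¹ • x) ∈ ν.support := by
      intro n
      induction n with
      | zero => simpa using hy
      | succ n ih =>
        convert hmaps _ ih using 1
        have h1 : x = (1 - c) • (1 - c)⁻¹ • x := by
          rw [smul_smul, mul_inv_cancel₀ (sub_pos.2 hc1).ne', one_smul]
        generalize (1 - c)⁻¹ • x = p at h1 ⊢
        rw [h1]
        module
    have hlim : Tendsto (fun n : ℕ => (1 - c)⁻¹ • x + c ^ n • (y - (1 - c)⁻¹ • x)) atTop
        (𝓝 ((1 - c)⁻¹ • x + (0 : ℝ) • (y - (1 - c)⁻¹ • x))) :=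
      ((tendsto_pow_atTop_nhds_zero_of_lt_one hc0.le hc1).smul_const _).const_add _
    rw [zero_smul, add_zero] at hlim
    exact Measure.isClosed_support.mem_of_tendsto hlim (Eventually.of_forall hiter)
  have h1 := hK.smul_mem (1 - c) (sub_pos.2 hc1).le _ (hν hpt)
  rwa [smul_smul, mul_inv_cancel₀ (sub_pos.2 hc1).ne', one_smul] at h1

/-- Inside a convolution semigroup, the power `μ̂_u(z)^(b^α)` of strict semistability is
`μ̂_{b^α u}(z)`. -/
theorem IsConvSemigroup.charFun_smul_of_semistable (hK : IsCone K) (hμ : IsConvSemigroup K μ)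
    {α b : ℝ} {u : E N} (hu : u ∈ K)
    (h : IsStrictlySemistable α b (μ u : Measure (E d))) (z : E d) :
    charFun (μ u : Measure (E d)) (b • z) = charFun (μ ((b ^ α) • u) : Measure (E d)) z := by
  obtain ⟨-, hb, φ, hφ, hφb⟩ := h
  obtain ⟨ψ, hψ, hψt⟩ := hμ.exists_distinguishedLog hK hu
  rw [← hφb, isDistinguishedLog_unique hφ hψ, hψt _ (Real.rpow_nonneg (zero_le_one.trans hb.le) _)]

/-- If scaling the parameter by `r` dilates `μ_u` by `c`, then dilating the mixing measure by `r`
dilates the mixture by `c`. -/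
theorem IsConvSemigroup.charFun_mixture_map_smul (hK : IsCone K) (hμ : IsConvSemigroup K μ)
    [IsProbabilityMeasure ν] (hν : ∀ᵐ u ∂ν, u ∈ K) {r : ℝ} (hr : 0 ≤ r) {c : ℝ}
    (h : ∀ u ∈ K, ∀ z,
      charFun (μ (r • u) : Measure (E d)) z = charFun (μ u : Measure (E d)) (c • z))
    (z : E d) :
    charFun (mixture K μ (ν.map (r • ·))) z = charFun (mixture K μ ν) (c • z) := by
  have : IsProbabilityMeasure (ν.map (r • ·)) := Measure.isProbabilityMeasure_map (by fun_prop)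
  have hνr := hK.ae_mem_map_smul hν hr
  rw [hμ.charFun_mixture hK hνr, hμ.charFun_mixture hK hν,
    integral_map (by fun_prop) (hμ.integrable_charFun hK hνr z).aestronglyMeasurable]
  refine integral_congr_ae ?_
  filter_upwards [hν] with u hu using h u hu z

theorem IsConvSemigroup.isCofactor_mixture (hK : IsCone K) (hμ : IsConvSemigroup K μ)
    [IsProbabilityMeasure ν] (hν : ∀ᵐ u ∂ν, u ∈ K) {r : ℝ} (hr0 : 0 < r) (hr1 : r < 1) {c : ℝ}
    (h : ∀ u ∈ K, ∀ z,
      charFun (μ (r • u) : Measure (E d)) z = charFun (μ u : Measure (E d)) (c • z))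
    {ν' : Measure (E N)} (hν' : IsCofactor r ν ν') :
    IsCofactor c (mixture K μ ν) (mixture K μ ν') := by
  have hν'K := hν'.ae_mem hK hr0 hr1 hν
  refine ⟨hμ.isInfDiv_mixture hK hν'K hν'.1, fun z => ?_⟩
  have := hν'.1.1
  have : IsProbabilityMeasure (ν.map (r • ·)) := Measure.isProbabilityMeasure_map (by fun_prop)
  have hνr := hK.ae_mem_map_smul hν hr0.le
  have := hμ.isProbabilityMeasure_mixture hK hνr
  have := hμ.isProbabilityMeasure_mixture hK hν'K
  conv_lhs => rw [hν'.eq_conv]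
  rw [hμ.mixture_conv hK hνr hν'K, charFun_conv, hμ.charFun_mixture_map_smul hK hν hr0.le h]

theorem mem_classLNat_zero {c : ℝ} : ν ∈ classLNat c 0 ↔
    IsProbabilityMeasure ν ∧ 0 < c ∧ c < 1 ∧ ∃ ν', IsCofactor c ν ν' := by
  rw [classLNat, Set.mem_ofPred_eq]

theorem mem_classLNat_succ {c : ℝ} {m : ℕ} : ν ∈ classLNat c (m + 1) ↔
    ν ∈ classLNat c 0 ∧ ∃ ν', IsCofactor c ν ν' ∧ ν' ∈ classLNat c m := by
  rw [mem_classLNat_zero, classLNat, Set.mem_ofPred_eq, mem_classLNat_zero]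

theorem IsConvSemigroup.mixture_mem_classLNat (hK : IsCone K) (hμ : IsConvSemigroup K μ)
    {r c : ℝ} (hc0 : 0 < c) (hc1 : c < 1)
    (h : ∀ u ∈ K, ∀ z,
      charFun (μ (r • u) : Measure (E d)) z = charFun (μ u : Measure (E d)) (c • z))
    (m : ℕ) {ν : Measure (E N)} (hν : ∀ᵐ u ∂ν, u ∈ K) (hm : ν ∈ classLNat r m) :
    mixture K μ ν ∈ classLNat c m := by
  have base : ∀ {ν : Measure (E N)}, (∀ᵐ u ∂ν, u ∈ K) → ν ∈ classLNat r 0 →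
      mixture K μ ν ∈ classLNat c 0 := by
    intro ν hν hm
    obtain ⟨hprob, hr0, hr1, ν', hν'⟩ := mem_classLNat_zero.1 hm
    exact mem_classLNat_zero.2 ⟨hμ.isProbabilityMeasure_mixture hK hν, hc0, hc1, _,
      hμ.isCofactor_mixture hK hν hr0 hr1 h hν'⟩
  induction m generalizing ν with
  | zero => exact base hν hm
  | succ m ih =>
    obtain ⟨h0, ν', hν', hm'⟩ := mem_classLNat_succ.1 hm
    refine mem_classLNat_succ.2 ⟨base hν h0, ?_⟩
    obtain ⟨hprob, hr0, hr1, -⟩ := mem_classLNat_zero.1 h0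
    exact ⟨_, hμ.isCofactor_mixture hK hν hr0 hr1 h hν', ih (hν'.ae_mem hK hr0 hr1 hν) hm'⟩

theorem IsConvSemigroup.mixture_mem_classL (hK : IsCone K) (hμ : IsConvSemigroup K μ)
    {r c : ℝ} (hc0 : 0 < c) (hc1 : c < 1)
    (h : ∀ u ∈ K, ∀ z,
      charFun (μ (r • u) : Measure (E d)) z = charFun (μ u : Measure (E d)) (c • z))
    (m : ℕ∞) (hν : ∀ᵐ u ∂ν, u ∈ K) (hm : ν ∈ classL m r) :
    mixture K μ ν ∈ classL m c := by
  cases m with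
  | top =>
    exact Set.mem_iInter.2 fun k =>
      hμ.mixture_mem_classLNat hK hc0 hc1 h k hν (Set.mem_iInter.1 hm k)
  | coe k => exact hμ.mixture_mem_classLNat hK hc0 hc1 h k hν hm

/-- The subordinated family is a convolution semigroup along rays. Its continuity at `0` is
tested against the bounded continuous extension of `u ↦ μ̂_u(z)` to the whole space. -/
theorem exists_distinguishedLog_subordinated {N₁ : ℕ} {K₁ : Set (E N₁)} (hK₁ : IsCone K₁)
    {ρ : E N₁ → ProbabilityMeasure (E N)} (hρ : IsConvSemigroup K₁ ρ)
    (hK : IsCone K) (hμ : IsConvSemigroup K μ)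
    (hρK : ∀ s ∈ K₁, ∀ᵐ u ∂(ρ s : Measure (E N)), u ∈ K) {s : E N₁} (hs : s ∈ K₁) :
    ∃ ψ : E d → ℂ, IsDistinguishedLog (subordinated K μ ρ s) ψ ∧ ∀ t : ℝ, 0 ≤ t → ∀ z,
      charFun (subordinated K μ ρ (t • s)) z = Complex.exp (t * ψ z) := by
  have hmem : ∀ t : ℝ, 0 ≤ t → t • s ∈ K₁ := fun t ht => hK₁.smul_mem t ht s hs
  have h := exists_distinguishedLog (ν := fun t : ℝ => subordinated K μ ρ (t • s))
    (fun t ht => hμ.isProbabilityMeasure_mixture hK (hρK _ (hmem t ht)))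
    (fun r t hr ht => by
      simp only [subordinated]
      rw [← hμ.mixture_conv hK (hρK _ (hmem r hr)) (hρK _ (hmem t ht)),
        hρ.conv_eq _ (hmem r hr) _ (hmem t ht), ← add_smul])
    (fun z => by
      obtain ⟨g, hg0, hg⟩ := hμ.exists_bounded_extension hK z
      rw [← hg0]
      refine (tendsto_integral_of_tendsto (hρ.tendsto_zero s hs) g).congr' ?_
      filter_upwards [self_mem_nhdsWithin] with t ht
      have htK := hρK _ (hmem t (le_of_lt ht))
      rw [subordinated, hμ.charFun_mixture hK htK]
      refine integral_congr_ae ?_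
      filter_upwards [htK] with u hu using (hg u hu).symm)
  simpa only [one_smul] using h

end Semigroup
end ConeSubordination

end

theorem theorem2 (N₁ N₂ d : ℕ)
    (K₁ : Set (ConeSubordination.E N₁)) (K₂ : Set (ConeSubordination.E N₂))
    (hK₁ : ConeSubordination.IsCone K₁) (hK₂ : ConeSubordination.IsCone K₂)
    (μ : ConeSubordination.E N₂ → ProbabilityMeasure (ConeSubordination.E d))
    (hμ : ConeSubordination.IsConvSemigroup K₂ μ)
    (ρ : ConeSubordination.E N₁ → ProbabilityMeasure (ConeSubordination.E N₂))
    (hρ : ConeSubordination.IsConvSemigroup K₁ ρ)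
    (hρK : ∀ s ∈ K₁, (ρ s : Measure (ConeSubordination.E N₂)).support ⊆ K₂)
    (α b : ℝ) (hα₀ : 0 < α) (hα₂ : α ≤ 2) (hb : 1 < b)
    (hμs : ∀ u ∈ K₂, ConeSubordination.IsStrictlySemistable α (b ^ (1 / α))
      (μ u : Measure (ConeSubordination.E d)))
    (s : ConeSubordination.E N₁) (hs : s ∈ K₁) :
    (∀ m : ℕ∞,
      (ρ s : Measure (ConeSubordination.E N₂)) ∈ ConeSubordination.classL m b⁻¹ →
      ConeSubordination.subordinated K₂ μ ρ s ∈ ConeSubordination.classL m (b ^ (-(1 / α)))) ∧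
    (∀ α' : ℝ, 0 < α' → α' ≤ 1 →
      ConeSubordination.IsStrictlySemistable α' b (ρ s : Measure (ConeSubordination.E N₂)) →
      ConeSubordination.IsStrictlySemistable (α * α') (b ^ (1 / α))
        (ConeSubordination.subordinated K₂ μ ρ s)) := by
  have hb0 : 0 < b := zero_lt_one.trans hb
  have hρae : ∀ s ∈ K₁, ∀ᵐ u ∂(ρ s : Measure (ConeSubordination.E N₂)), u ∈ K₂ := fun s hs =>
    (ConeSubordination.ae_mem_iff_support_subset hK₂.isClosed).2 (hρK s hs)
  have hbα : (b ^ (1 / α)) ^ α = b := by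
    rw [← Real.rpow_mul hb0.le, one_div, inv_mul_cancel₀ hα₀.ne', Real.rpow_one]
  have hscale : ∀ u ∈ K₂, ∀ z, charFun (μ (b • u) : Measure (ConeSubordination.E d)) z =
      charFun (μ u : Measure (ConeSubordination.E d)) (b ^ (1 / α) • z) := fun u hu z => by
    rw [hμ.charFun_smul_of_semistable hK₂ hu (hμs u hu) z, hbα]
  refine ⟨fun m hm => ?_, fun α' hα'₀ _ hss => ?_⟩
  · refine hμ.mixture_mem_classL hK₂ (Real.rpow_pos_of_pos hb0 _)
      (Real.rpow_lt_one_of_one_lt_of_neg hb (neg_lt_zero.2 (one_div_pos.2 hα₀)))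
      (fun u hu z => ?_) m (hρae s hs) hm
    have h := hscale _ (hK₂.smul_mem b⁻¹ (inv_nonneg.2 hb0.le) u hu) (b ^ (-(1 / α)) • z)
    rw [smul_smul, mul_inv_cancel₀ hb0.ne', one_smul, smul_smul, ← Real.rpow_add hb0,
      add_neg_cancel, Real.rpow_zero, one_smul] at h
    exact h.symm
  · obtain ⟨ψ, hψ, hψt⟩ :=
      ConeSubordination.exists_distinguishedLog_subordinated hK₁ hρ hK₂ hμ hρae hs
    refine ⟨hμ.isInfDiv_mixture hK₂ (hρae s hs) hss.1,
      Real.one_lt_rpow hb (one_div_pos.2 hα₀), ψ, hψ, fun z => ?_⟩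
    -- Semistability of `ρ_s` identifies `ρ_{b^α' s}` with the dilation of `ρ_s` by `b`.
    have hmap : (ρ (b ^ α' • s) : Measure (ConeSubordination.E N₂)) =
        (ρ s : Measure (ConeSubordination.E N₂)).map (b • ·) := by
      have : IsProbabilityMeasure ((ρ s : Measure (ConeSubordination.E N₂)).map (b • ·)) :=
        Measure.isProbabilityMeasure_map (by fun_prop)
      refine Measure.ext_of_charFun (funext fun w => ?_)
      rw [charFun_map_smul, hρ.charFun_smul_of_semistable hK₁ hs hss]
    rw [Real.rpow_mul (Real.rpow_nonneg hb0.le _), hbα,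
      ← hψt _ (Real.rpow_nonneg hb0.le _), ConeSubordination.subordinated, hmap,
      hμ.charFun_mixture_map_smul hK₂ (hρae s hs) hb0.le hscale, ConeSubordination.subordinated]
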